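/- There exists an absolute constant $c>0$ such that the following is true. Let $\mathbb{F}$ be any field, let $0<\varepsilon<1$, and let $w:\mathbb{R}\to\mathbb{R}$ be a non-decreasing function with $w(x)\geq 1$ for all $x$. Let $k\ge 1$ and let $2\leq d_1\leq d_2\leq\ldots\leq d_k$ be integers. Let $K>0$ and $L>0$ be such that (i) $\displaystyle\sum_{i=1}^{k}\frac{w(d_i)}{d_i}\leq K\left(\sum_{i=1}^{k}\frac{\log d_i}{\log d_k}\right)\cdot\frac{w(d_1)}{d_k}$, and (ii) $\displaystyle\sum_{i=1}^{k}\frac{w(d_i)}{d_i}\geq L\left(\sum_{i=1}^{k}\frac{\log d_i}{\log d_k}\right)\cdot\frac{w(d_k)}{d_k}$. Let $n=\prod_{i=1}^{k}d_i$, consider arbitrary matrices $M_i\in\mathbb{F}^{d_i\times d_i}$, and let $M=\bigotimes_{i=1}^{k}M_i$ be their Kronecker product. Then $$R^{rc}_{\mathbb{F}}\left(M,\,2d_k\cdot n^{1-\gamma}\right)\leq n^{\varepsilon},\qquad\text{where}\quad \gamma=\frac{cL\varepsilon^2}{d_k\log d_k\cdot K^2\log^2(2K/\varepsilon)}.$$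 Here $\log$ is the natural logarithm and, for $A\in\mathbb{F}^{n\times n}$ and a real number $r\geq 0$, the row-column rigidity $R^{rc}_{\mathbb{F}}(A,r)$ is the minimal $t$ for which there exists $Z\in\mathbb{F}^{n\times n}$ such that $\operatorname{rank}(A-Z)\leq r$ and every row and every column of $Z$ has at most $t$ non-zero entries. -/

import Mathlib

/-- Every row and every column of the square matrix `Z` has at most `t` non-zero entries. -/
def IsRowColSparse {𝔽 ι : Type*} [Field 𝔽] (Z : Matrix ι ι 𝔽) (t : ℕ) : Prop :=
  (∀ i, {j | Z i j ≠ 0}.ncard ≤ t) ∧ (∀ j, {i | Z i j ≠ 0}.ncard ≤ t)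

/-- Row-column rigidity: the minimal `t` for which there is a matrix `Z` with `rank (A - Z) ≤ r`
such that every row and column of `Z` has at most `t` non-zero entries. The target rank `r` is
a non-negative real number; the minimum then exists, see `rcRigidity_spec`. -/
noncomputable def rcRigidity {𝔽 ι : Type*} [Field 𝔽] [Fintype ι]
    (A : Matrix ι ι 𝔽) (r : ℝ) : ℕ :=
  sInf {t : ℕ | ∃ Z : Matrix ι ι 𝔽, ((A - Z).rank : ℝ) ≤ r ∧ IsRowColSparse Z t}

/-- For `r ≥ 0` the minimum in the definition of the row-column rigidity is attained. -/
theorem rcRigidity_spec {𝔽 ι : Type*} [Field 𝔽] [Fintype ι]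
    (A : Matrix ι ι 𝔽) (r : ℝ) (hr : 0 ≤ r) :
    ∃ Z : Matrix ι ι 𝔽, ((A - Z).rank : ℝ) ≤ r ∧ IsRowColSparse Z (rcRigidity A r) := by
  have h : {t : ℕ | ∃ Z : Matrix ι ι 𝔽, ((A - Z).rank : ℝ) ≤ r ∧ IsRowColSparse Z t}.Nonempty := by
    refine ⟨Nat.card ι, A, by simpa using hr, fun i => ?_, fun j => ?_⟩ <;>
      exact Set.ncard_le_card _
  exact Nat.sInf_mem h

/-- The Kronecker product of the square matrices `M i`; its rows and columns are indexed by the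
tuples `x` with `x i ∈ Fin (d i)`. -/
def kroneckerProd {𝔽 : Type*} [Field 𝔽] {m : ℕ} {d : Fin m → ℕ}
    (M : (i : Fin m) → Matrix (Fin (d i)) (Fin (d i)) 𝔽) :
    Matrix ((i : Fin m) → Fin (d i)) ((i : Fin m) → Fin (d i)) 𝔽 :=
  Matrix.of fun x y => ∏ i, M i (x i) (y i)

/-! Any `d × d` matrix, singular or not, is a product of `d` matrices that are monomial up to one
column (`isSpecialProd_card`), so the Kronecker product is a product of `D = d_k` Kronecker products
of such special matrices. Rank errors add and sparsities multiply under products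
(`exists_sparse_of_isSpecialProd`), so one special stage suffices. In a stage, a non-zero entry at
`(x, y)` forces each `y i` to be `a i` or `σ i (x i)`. Let `W y` be the total weight of the
coordinates with `y i = a i`. Passing from `τ x = (σ i (x i))` to `y` raises `W` by at least the
minimal weight at every coordinate that changes. By Chernoff, `W` is within a factor `1 ± δ` of its
mean outside few rows and columns; deleting these costs little rank, and the surviving entries have
`y` in a small Hamming ball around `τ x` (`exists_sparse_of_isSpecial`). Hypothesis (i) bounds the
radius, (ii) the deleted rank. -/

/-- A monomial matrix up to one arbitrary column. -/
def IsSpecial {𝔽 ι : Type*} [Field 𝔽] (E : Matrix ι ι 𝔽) (a : ι) (σ : Equiv.Perm ι) : Prop :=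
  ∀ x y, E x y ≠ 0 → y = a ∨ y = σ x

/-- `X` is a product of `m` matrices that are monomial up to one column. -/
def IsSpecialProd {𝔽 ι : Type*} [Field 𝔽] [Fintype ι] [DecidableEq ι] :
    ℕ → Matrix ι ι 𝔽 → Prop
  | 0, X => X = 1
  | m + 1, X => ∃ Y E, IsSpecialProd m Y ∧ (∃ a σ, IsSpecial E a σ) ∧ X = Y * E

/-! ### Factorization into special matrices -/

section Factor

variable {𝔽 ι : Type*} [Field 𝔽] [DecidableEq ι]

theorem isSpecial_updateCol_one (a : ι) (v : ι → 𝔽) :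
    IsSpecial ((1 : Matrix ι ι 𝔽).updateCol a v) a 1 := by
  intro x y h
  by_cases hy : y = a
  · exact Or.inl hy
  · right
    rw [Matrix.updateCol_ne hy, Matrix.one_apply] at h
    simpa [eq_comm] using h

variable [Fintype ι]

theorem IsSpecialProd.succ [Nonempty ι] {m : ℕ} {X : Matrix ι ι 𝔽} (h : IsSpecialProd m X) :
    IsSpecialProd (m + 1) X := by
  obtain ⟨a⟩ := ‹Nonempty ι›
  refine ⟨X, 1, h, ⟨a, 1, fun x y hxy => Or.inr ?_⟩, (mul_one X).symm⟩
  rw [Matrix.one_apply] at hxy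
  simpa [eq_comm] using hxy

theorem IsSpecialProd.mono [Nonempty ι] {m m' : ℕ} {X : Matrix ι ι 𝔽} (h : IsSpecialProd m X)
    (hm : m ≤ m') : IsSpecialProd m' X := by
  induction hm with
  | refl => exact h
  | step _ ih => exact ih.succ

theorem IsSpecialProd.submatrix {m : ℕ} {X : Matrix ι ι 𝔽} (h : IsSpecialProd (m + 1) X)
    (π : Equiv.Perm ι) : IsSpecialProd (m + 1) (X.submatrix id π) := by
  obtain ⟨Y, E, hY, ⟨a, σ, hE⟩, rfl⟩ := h
  refine ⟨Y, E.submatrix id π, hY, ⟨π.symm a, σ.trans π.symm, fun x y hxy => ?_⟩, ?_⟩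
  · rcases hE x (π y) hxy with h | h
    · left; rw [← h]; simp
    · right; simp [← h]
  · ext x y
    simp [Matrix.mul_apply]

open Matrix in
theorem updateCol_one_mulVec (a : ι) (v w : ι → 𝔽) :
    (1 : Matrix ι ι 𝔽).updateCol a v *ᵥ w = w + w a • (v - Pi.single a 1) := by
  ext x
  have : ∀ y, (1 : Matrix ι ι 𝔽).updateCol a v x y * w y =
      (1 : Matrix ι ι 𝔽) x y * w y + if y = a then (v x - (1 : Matrix ι ι 𝔽) x y) * w y else 0 := by
    intro y
    by_cases hy : y = a
    · subst hy; simp; ring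
    · simp [hy]
  simp only [Matrix.mulVec, dotProduct, this, Finset.sum_add_distrib]
  simp [Matrix.one_apply, Pi.single_apply]
  ring

open Matrix in
/-- Exchange of columns: the columns of `M` enter the product one by one. -/
theorem exists_isSpecialProd_columns (M : Matrix ι ι 𝔽) (m : ℕ) (hm : m ≤ Fintype.card ι) :
    ∃ (J : Finset ι) (π : Equiv.Perm ι) (X : Matrix ι ι 𝔽), J.card = m ∧ IsSpecialProd m X ∧
      (∀ j ∈ J, X *ᵥ Pi.single (π j) 1 = M.col j) ∧ ∀ l, ∃ v, X *ᵥ v = M.col l := by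
  induction m with
  | zero => exact ⟨∅, 1, 1, rfl, rfl, by simp, fun l => ⟨M.col l, by simp⟩⟩
  | succ m ih =>
    obtain ⟨J, π, X, hJ, hX, hcol, hspan⟩ := ih (by omega)
    have step : ∀ a v, IsSpecialProd (m + 1) (X * (1 : Matrix ι ι 𝔽).updateCol a v) :=
      fun a v => ⟨X, _, hX, ⟨a, 1, isSpecial_updateCol_one a v⟩, rfl⟩
    -- Is there a new column of `M` with a pivot at a position not yet occupied by `J`?
    by_cases h : ∃ l ∉ J, ∃ v, X *ᵥ v = M.col l ∧ ∃ a, (∀ j ∈ J, π j ≠ a) ∧ v a ≠ 0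
    · obtain ⟨l, hl, v, hv, a, ha, hva⟩ := h
      refine ⟨insert l J, π.trans (Equiv.swap a (π l)), _, by simp [hl, hJ], step a v, ?_, ?_⟩
      · intro j hj
        rw [← mulVec_mulVec, updateCol_one_mulVec]
        rcases Finset.mem_insert.1 hj with rfl | hj
        · simp [hv]
        · have h1 : π j ≠ π l := fun e => hl (π.injective e ▸ hj)
          simp [Equiv.swap_apply_of_ne_of_ne (ha j hj) h1, (ha j hj).symm, hcol j hj]
      · intro l'
        obtain ⟨v', hv'⟩ := hspan l'
        -- The preimage of `v'` under the elementary factor, invertible because `v a ≠ 0`.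
        refine ⟨v' - (v' a / v a) • (v - Pi.single a 1), ?_⟩
        rw [← mulVec_mulVec, updateCol_one_mulVec, ← hv']
        congr 1
        ext x
        simp
        field_simp
        ring
    -- Without a pivot, the remaining columns of `M` are combinations of the columns of `X` at `π ''
    -- J`, so overwriting column `π l` loses nothing even if it is not invertible.
    · push Not at h
      obtain ⟨l, hl⟩ : ∃ l, l ∉ J := by
        by_contra! hc
        have := (Finset.card_eq_iff_eq_univ J).2 (Finset.eq_univ_iff_forall.2 hc)
        omega
      obtain ⟨v, hv⟩ := hspan l
      have hne : ∀ l ∉ J, ∀ j ∈ J, π j ≠ π l := fun l hl j hj e => hl (π.injective e ▸ hj)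
      have hcol' : ∀ j ∈ insert l J,
          (X * (1 : Matrix ι ι 𝔽).updateCol (π l) v) *ᵥ Pi.single (π j) 1 = M.col j := by
        intro j hj
        rw [← mulVec_mulVec, updateCol_one_mulVec]
        rcases Finset.mem_insert.1 hj with rfl | hj
        · simp [hv]
        · simp [(hne l hl j hj).symm, hcol j hj]
      refine ⟨insert l J, π, _, by simp [hl, hJ], step (π l) v, hcol', fun l' => ?_⟩
      by_cases hl' : l' ∈ J
      · exact ⟨_, hcol' l' (Finset.mem_insert_of_mem hl')⟩
      · obtain ⟨v', hv'⟩ := hspan l'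
        refine ⟨v', ?_⟩
        rw [← mulVec_mulVec, updateCol_one_mulVec, h l' hl' v' hv' (π l) (hne l hl)]
        simpa using hv'

/-- After all columns are exchanged, the product is `M` up to a column permutation, which the last
factor absorbs. -/
theorem isSpecialProd_card [Nonempty ι] (M : Matrix ι ι 𝔽) :
    IsSpecialProd (Fintype.card ι) M := by
  obtain ⟨J, π, X, hJ, hX, hcol, -⟩ := exists_isSpecialProd_columns M _ le_rfl
  obtain rfl : J = Finset.univ := (Finset.card_eq_iff_eq_univ J).1 hJ
  have hM : M = X.submatrix id π := by
    ext x j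
    have := congrFun (hcol j (Finset.mem_univ j)) x
    simpa using this.symm
  obtain ⟨m, hm⟩ := Nat.exists_eq_succ_of_ne_zero (Fintype.card_ne_zero (α := ι))
  rw [hm] at hX ⊢
  rw [hM]
  exact hX.submatrix π

end Factor

/-! ### Sparsity and rank under products -/

section RowCol

variable {𝔽 : Type*} [Field 𝔽]

theorem IsRowColSparse.mul {ι : Type*} [Fintype ι] {Y Z : Matrix ι ι 𝔽} {s t : ℕ}
    (hY : IsRowColSparse Y s) (hZ : IsRowColSparse Z t) : IsRowColSparse (Y * Z) (s * t) := by
  classical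
  have key : ∀ (P Q : ι → ι → Prop) (R : ι → ι → Prop) (s t : ℕ),
      (∀ i, {j | P i j}.ncard ≤ s) → (∀ i, {j | Q i j}.ncard ≤ t) →
      (∀ i j, R i j → ∃ l, P i l ∧ Q l j) → ∀ i, {j | R i j}.ncard ≤ s * t := by
    intro P Q R s t hP hQ hR i
    have hsub : {j | R i j} ⊆ ↑((Finset.univ.filter (P i)).biUnion
        fun l => Finset.univ.filter (Q l)) := by
      intro j hj
      obtain ⟨l, h1, h2⟩ := hR i j hj
      simp only [Finset.coe_biUnion, Set.mem_iUnion]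
      exact ⟨l, by simpa using h1, by simpa using h2⟩
    refine (Set.ncard_le_ncard hsub (Finset.finite_toSet _)).trans ?_
    rw [Set.ncard_coe_finset]
    refine (Finset.card_biUnion_le_card_mul _ _ t fun l _ => ?_).trans ?_
    · simpa [Set.ncard_eq_toFinset_card'] using hQ l
    · exact Nat.mul_le_mul_right _ (by simpa [Set.ncard_eq_toFinset_card'] using hP i)
  have hmul : ∀ i j, (Y * Z) i j ≠ 0 → ∃ l, Y i l ≠ 0 ∧ Z l j ≠ 0 := by
    intro i j h
    rw [Matrix.mul_apply] at h
    obtain ⟨l, -, hl⟩ := Finset.exists_ne_zero_of_sum_ne_zero h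
    exact ⟨l, left_ne_zero_of_mul hl, right_ne_zero_of_mul hl⟩
  refine ⟨key _ _ _ s t hY.1 hZ.1 hmul, ?_⟩
  rw [mul_comm]
  refine key (fun j l => Z l j ≠ 0) (fun l i => Y i l ≠ 0) (fun j i => (Y * Z) i j ≠ 0) t s
    hZ.2 hY.2 fun j i h => ?_
  obtain ⟨l, h1, h2⟩ := hmul i j h
  exact ⟨l, h2, h1⟩

theorem rank_add_le_rank_add_rank {ι : Type*} [Fintype ι] (A B : Matrix ι ι 𝔽) :
    (A + B).rank ≤ A.rank + B.rank := by
  rw [Matrix.rank, Matrix.rank, Matrix.rank, Matrix.mulVecLin_add]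
  exact (Submodule.finrank_mono (LinearMap.range_add_le _ _)).trans
    (Submodule.finrank_add_le_finrank_add_finrank _ _)

theorem rank_mul_sub_mul_le {ι : Type*} [Fintype ι] [DecidableEq ι] (A B Y Z : Matrix ι ι 𝔽) :
    (A * B - Y * Z).rank ≤ (A - Y).rank + (B - Z).rank := by
  have : A * B - Y * Z = (A - Y) * B + Y * (B - Z) := by
    rw [sub_mul, mul_sub]; abel
  rw [this]
  exact (rank_add_le_rank_add_rank _ _).trans
    (add_le_add (Matrix.rank_mul_le_left _ _) (Matrix.rank_mul_le_right _ _))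

theorem rank_le_card_of_rows {ι : Type*} [Fintype ι] (A : Matrix ι ι 𝔽)
    (p : ι → Prop) [DecidablePred p] (h : ∀ x y, ¬ p x → A x y = 0) :
    A.rank ≤ (Finset.univ.filter p).card := by
  refine A.rank_le_card_of_support_subset _ (Function.support_subset_iff'.2 fun x hx => ?_)
  exact funext fun y => h x y (by simpa using hx)

theorem rank_sub_restrict_le {ι : Type*} [Fintype ι] [DecidableEq ι] (A : Matrix ι ι 𝔽)
    (p q : ι → Prop) [DecidablePred p] [DecidablePred q] :
    (A - Matrix.of fun x y => if ¬ p x ∧ ¬ q y then A x y else 0).rank ≤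
      (Finset.univ.filter p).card + (Finset.univ.filter q).card := by
  have : (A - Matrix.of fun x y => if ¬ p x ∧ ¬ q y then A x y else 0) =
      (Matrix.of fun x y => if p x then A x y else 0) +
      Matrix.of fun x y => if ¬ p x ∧ q y then A x y else 0 := by
    ext x y
    by_cases hp : p x <;> by_cases hq : q y <;> simp [hp, hq]
  rw [this]
  refine (rank_add_le_rank_add_rank _ _).trans (add_le_add ?_ ?_)
  · exact rank_le_card_of_rows _ p fun x y hx => by simp [hx]
  · rw [← Matrix.rank_transpose]
    exact rank_le_card_of_rows _ q fun x y hx => by simp [hx]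

theorem kroneckerProd_mul {m : ℕ} {d : Fin m → ℕ}
    (M N : (i : Fin m) → Matrix (Fin (d i)) (Fin (d i)) 𝔽) :
    kroneckerProd (fun i => M i * N i) = kroneckerProd M * kroneckerProd N := by
  ext x y
  simp only [kroneckerProd, Matrix.of_apply, Matrix.mul_apply, ← Finset.prod_mul_distrib]
  rw [Finset.prod_univ_sum, Fintype.piFinset_univ]

theorem kroneckerProd_one {m : ℕ} {d : Fin m → ℕ} :
    kroneckerProd (fun i => (1 : Matrix (Fin (d i)) (Fin (d i)) 𝔽)) = 1 := by
  ext x y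
  simp only [kroneckerProd, Matrix.of_apply, Matrix.one_apply]
  rw [Finset.prod_ite_zero]
  simp [funext_iff]

theorem isRowColSparse_one {ι : Type*} [DecidableEq ι] :
    IsRowColSparse (1 : Matrix ι ι 𝔽) 1 := by
  constructor <;> intro i
  · have : {j | (1 : Matrix ι ι 𝔽) i j ≠ 0} = {i} := by
      ext j; simp [Matrix.one_apply, eq_comm]
    rw [this, Set.ncard_singleton]
  · have : {j | (1 : Matrix ι ι 𝔽) j i ≠ 0} = {i} := by
      ext j; simp [Matrix.one_apply]
    rw [this, Set.ncard_singleton]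

/-- A bound for Kronecker products of special matrices passes to products of `s` of them. -/
theorem exists_sparse_of_isSpecialProd {m : ℕ} {d : Fin m → ℕ} (r : ℝ) (t : ℕ)
    (hstage : ∀ (E : (i : Fin m) → Matrix (Fin (d i)) (Fin (d i)) 𝔽),
      (∀ i, ∃ a σ, IsSpecial (E i) a σ) →
      ∃ Z, ((kroneckerProd E - Z).rank : ℝ) ≤ r ∧ IsRowColSparse Z t)
    (s : ℕ) (M : (i : Fin m) → Matrix (Fin (d i)) (Fin (d i)) 𝔽)
    (hM : ∀ i, IsSpecialProd s (M i)) :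
    ∃ Z, ((kroneckerProd M - Z).rank : ℝ) ≤ s * r ∧ IsRowColSparse Z (t ^ s) := by
  induction s generalizing M with
  | zero =>
    obtain rfl : M = fun i => 1 := funext hM
    exact ⟨1, by simp [kroneckerProd_one], isRowColSparse_one⟩
  | succ s ih =>
    choose Y E hY hE hYE using hM
    obtain rfl : M = fun i => Y i * E i := funext hYE
    obtain ⟨Z₁, h1, h1'⟩ := ih Y hY
    obtain ⟨Z₂, h2, h2'⟩ := hstage E hE
    refine ⟨Z₁ * Z₂, ?_, h1'.mul h2'⟩
    rw [kroneckerProd_mul]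
    have := rank_mul_sub_mul_le (kroneckerProd Y) (kroneckerProd E) Z₁ Z₂
    have : ((kroneckerProd Y * kroneckerProd E - Z₁ * Z₂).rank : ℝ) ≤
        (kroneckerProd Y - Z₁).rank + (kroneckerProd E - Z₂).rank := by exact_mod_cast this
    push_cast
    linarith

end RowCol

/-! ### Chernoff bounds and Hamming balls -/

section Counting

variable {m : ℕ} {d : Fin m → ℕ}

/-- Moment generating function of the total weight of the coordinates with `y i = a i`. -/
theorem sum_exp_weight_le (hd : ∀ i, 0 < d i) (a : (i : Fin m) → Fin (d i)) (w : Fin m → ℝ)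
    (hw : ∀ i, 0 ≤ w i) (l η : ℝ) (hη : η ≤ 1) (hl : ∀ i, |l| * w i ≤ η) :
    ∑ y : (i : Fin m) → Fin (d i), Real.exp (l * ∑ i, if y i = a i then w i else 0) ≤
      (∏ i, (d i : ℝ)) * Real.exp ((l + |l| * η) * ∑ i, w i / d i) := by
  have h1 : ∀ y : (i : Fin m) → Fin (d i), Real.exp (l * ∑ i, if y i = a i then w i else 0) =
      ∏ i, (1 + if y i = a i then Real.exp (l * w i) - 1 else 0) := by
    intro y
    rw [Finset.mul_sum, Real.exp_sum]
    refine Finset.prod_congr rfl fun i _ => ?_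
    split_ifs <;> simp
  simp only [h1]
  rw [← Fintype.piFinset_univ,
    ← Finset.prod_univ_sum (fun _ => Finset.univ)
      (fun i (z : Fin (d i)) => 1 + if z = a i then Real.exp (l * w i) - 1 else 0),
    Finset.mul_sum, Real.exp_sum, ← Finset.prod_mul_distrib]
  refine Finset.prod_le_prod (fun i _ => Finset.sum_nonneg fun z _ => ?_) fun i _ => ?_
  · split_ifs
    · simp [Real.exp_nonneg]
    · simp
  · have hdi : (0 : ℝ) < d i := by exact_mod_cast hd i
    simp only [Finset.sum_add_distrib, Finset.sum_ite_eq', Finset.mem_univ, if_true,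
      Finset.sum_const, Finset.card_univ, Fintype.card_fin, nsmul_eq_mul, mul_one]
    have habs : |l * w i| ≤ η := by rw [abs_mul, abs_of_nonneg (hw i)]; exact hl i
    have h2 := (abs_le.1 (Real.abs_exp_sub_one_sub_id_le (habs.trans hη))).2
    have h3 : (l * w i) ^ 2 ≤ |l| * w i * η := by
      rw [← sq_abs, abs_mul, abs_of_nonneg (hw i), sq]
      exact mul_le_mul_of_nonneg_left (hl i) (mul_nonneg (abs_nonneg _) (hw i))
    have h4 : (l + |l| * η) * (w i / d i) + 1 ≤ Real.exp ((l + |l| * η) * (w i / d i)) :=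
      Real.add_one_le_exp _
    calc (d i : ℝ) + (Real.exp (l * w i) - 1) ≤ d i + (l + |l| * η) * w i := by nlinarith
      _ = d i * ((l + |l| * η) * (w i / d i) + 1) := by field_simp; ring
      _ ≤ _ := mul_le_mul_of_nonneg_left h4 hdi.le

/-- Chernoff's bound for both tails, selected by the sign `e`. -/
theorem card_weight_deviation_le (hd : ∀ i, 0 < d i) (a : (i : Fin m) → Fin (d i)) (w : Fin m → ℝ)
    (hw : ∀ i, 0 ≤ w i) (wmax : ℝ) (hmax : 0 < wmax) (hwmax : ∀ i, w i ≤ wmax)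
    (δ : ℝ) (hδ : 0 < δ) (hδ1 : δ ≤ 1) (e : ℝ) (he : |e| = 1) :
    ((Finset.univ.filter fun y : (i : Fin m) → Fin (d i) =>
      (e + δ) * ∑ i, w i / d i < e * ∑ i, if y i = a i then w i else 0).card : ℝ) ≤
      (∏ i, (d i : ℝ)) * Real.exp (-(δ ^ 2 / 4 * ((∑ i, w i / d i) / wmax))) := by
  set E := ∑ i, w i / d i with hE
  -- With this exponent the second-order term uses up only half of the gain in Markov's inequality.
  have hlpos : 0 < δ / (2 * wmax) := by positivity
  have habs : |e * (δ / (2 * wmax))| = δ / (2 * wmax) := by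
    rw [abs_mul, he, one_mul, abs_of_pos hlpos]
  have hmgf := sum_exp_weight_le hd a w hw (e * (δ / (2 * wmax))) (δ / 2) (by linarith)
    (fun i => by
      rw [habs]
      calc δ / (2 * wmax) * w i ≤ δ / (2 * wmax) * wmax :=
            mul_le_mul_of_nonneg_left (hwmax i) hlpos.le
        _ = δ / 2 := by field_simp)
  rw [habs] at hmgf
  have hmarkov : ((Finset.univ.filter fun y : (i : Fin m) → Fin (d i) =>
      (e + δ) * E < e * ∑ i, if y i = a i then w i else 0).card : ℝ) *
      Real.exp (δ / (2 * wmax) * ((e + δ) * E)) ≤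
      (∏ i, (d i : ℝ)) * Real.exp ((e * (δ / (2 * wmax)) + δ / (2 * wmax) * (δ / 2)) * E) := by
    refine le_trans ?_ hmgf
    rw [← nsmul_eq_mul, ← Finset.sum_const]
    refine (Finset.sum_le_sum fun y hy => ?_).trans
      (Finset.sum_le_sum_of_subset_of_nonneg (Finset.filter_subset _ _)
        fun _ _ _ => (Real.exp_nonneg _))
    rw [Finset.mem_filter] at hy
    rw [Real.exp_le_exp, mul_comm e, mul_assoc]
    exact mul_le_mul_of_nonneg_left hy.2.le hlpos.le
  rw [← le_div_iff₀ (Real.exp_pos _), mul_div_assoc, ← Real.exp_sub] at hmarkov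
  refine hmarkov.trans (le_of_eq ?_)
  congr 2
  field_simp
  ring

/-- Volume of a Hamming ball. -/
theorem card_hammingBall_le (y : (i : Fin m) → Fin (d i)) (s θ : ℝ)
    (hθ : 0 < θ) (hθ1 : θ ≤ 1) :
    ((Finset.univ.filter fun u : (i : Fin m) → Fin (d i) => (hammingDist u y : ℝ) ≤ s).card : ℝ) ≤
      Real.exp (s * Real.log (1 / θ) + θ * ∑ i, (d i : ℝ)) := by
  have hlog : 0 ≤ Real.log (1 / θ) := Real.log_nonneg (by rw [le_div_iff₀ hθ]; linarith)
  have h1 : ∀ u : (i : Fin m) → Fin (d i),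
      θ ^ hammingDist u y = ∏ i, if u i ≠ y i then θ else 1 := by
    intro u
    rw [Finset.prod_ite]
    simp [hammingDist]
  -- Points of the ball contribute at least `θ ^ s` each, while the full sum factors over
  -- coordinates.
  have hsum : ∑ u : (i : Fin m) → Fin (d i), θ ^ hammingDist u y ≤
      Real.exp (θ * ∑ i, (d i : ℝ)) := by
    simp only [h1]
    rw [← Fintype.piFinset_univ, ← Finset.prod_univ_sum (fun _ => Finset.univ)
      (fun i (z : Fin (d i)) => if z ≠ y i then θ else 1), Finset.mul_sum, Real.exp_sum]
    refine Finset.prod_le_prod (fun i _ => Finset.sum_nonneg fun z _ => ?_) fun i _ => ?_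
    · split_ifs <;> linarith
    · refine le_trans ?_ (Real.add_one_le_exp _)
      have : ∀ z : Fin (d i), (if z ≠ y i then θ else 1) ≤ θ + if z = y i then 1 else 0 := by
        intro z
        by_cases hz : z = y i <;> simp [hz, hθ.le]
      refine (Finset.sum_le_sum fun z _ => this z).trans (le_of_eq ?_)
      simp [Finset.sum_add_distrib, mul_comm]
  rw [Real.exp_add, ← div_le_iff₀' (Real.exp_pos _)]
  refine le_trans ?_ hsum
  rw [div_eq_mul_inv, ← Real.exp_neg, ← nsmul_eq_mul, ← Finset.sum_const]
  refine (Finset.sum_le_sum fun u hu => ?_).trans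
    (Finset.sum_le_sum_of_subset_of_nonneg (Finset.filter_subset _ _)
      fun _ _ _ => pow_nonneg hθ.le _)
  rw [Finset.mem_filter] at hu
  rw [← Real.exp_log hθ, ← Real.exp_nat_mul, Real.exp_le_exp, Real.exp_log hθ]
  rw [one_div, Real.log_inv] at hlog ⊢
  nlinarith [hu.2]

end Counting

/-! ### One stage: Kronecker products of special matrices -/

section Stage

variable {𝔽 : Type*} [Field 𝔽] {m : ℕ} {d : Fin m → ℕ}

/-- Discarding the rows and columns of atypical weight leaves a sparse matrix. -/
theorem exists_sparse_of_isSpecial (hd : ∀ i, 0 < d i) (w : Fin m → ℝ)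
    (wmin wmax : ℝ) (hmin : 0 < wmin) (hwmin : ∀ i, wmin ≤ w i) (hmax : 0 < wmax)
    (hwmax : ∀ i, w i ≤ wmax) (δ : ℝ) (hδ : 0 < δ) (hδ1 : δ ≤ 1)
    (s θ : ℝ) (hs : 2 * δ * ∑ i, w i / d i ≤ s * wmin) (hθ : 0 < θ) (hθ1 : θ ≤ 1)
    (E : (i : Fin m) → Matrix (Fin (d i)) (Fin (d i)) 𝔽)
    (hE : ∀ i, ∃ a σ, IsSpecial (E i) a σ) :
    ∃ Z, ((kroneckerProd E - Z).rank : ℝ) ≤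
        2 * ((∏ i, (d i : ℝ)) * Real.exp (-(δ ^ 2 / 4 * ((∑ i, w i / d i) / wmax)))) ∧
      IsRowColSparse Z ⌊Real.exp (s * Real.log (1 / θ) + θ * ∑ i, (d i : ℝ))⌋₊ := by
  classical
  choose a σ hE using hE
  have hw : ∀ i, 0 ≤ w i := fun i => hmin.le.trans (hwmin i)
  let W : ((i : Fin m) → Fin (d i)) → ℝ := fun y => ∑ i, if y i = a i then w i else 0
  let τ : Equiv.Perm ((i : Fin m) → Fin (d i)) := Equiv.piCongrRight σ
  let q : ((i : Fin m) → Fin (d i)) → Prop := fun y => (1 + δ) * ∑ i, w i / d i < 1 * W y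
  let p : ((i : Fin m) → Fin (d i)) → Prop := fun u => (-1 + δ) * ∑ i, w i / d i < -1 * W u
  let Z := Matrix.of fun x y => if ¬ p (τ x) ∧ ¬ q y then kroneckerProd E x y else 0
  have hZ : ∀ x y, Z x y ≠ 0 → (hammingDist (τ x) y : ℝ) ≤ s := by
    intro x y hxy
    simp only [Z, Matrix.of_apply, ne_eq, ite_eq_right_iff, not_forall] at hxy
    obtain ⟨⟨hp, hq⟩, hne⟩ := hxy
    simp only [p, q, not_lt] at hp hq
    rw [kroneckerProd, Matrix.of_apply] at hne
    have hne' : ∀ i, y i = a i ∨ y i = τ x i := fun i =>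
      hE i (x i) (y i) (Finset.prod_ne_zero_iff.1 hne i (Finset.mem_univ i))
    -- Where `τ x` and `y` differ, `y i = a i ≠ τ x i`, so `W` can only increase.
    have hterm : ∀ i, (if τ x i ≠ y i then wmin else 0) ≤
        (if y i = a i then w i else 0) - if τ x i = a i then w i else 0 := by
      intro i
      rcases eq_or_ne (τ x i) (y i) with h | h
      · simp [h]
      · have hy : y i = a i := (hne' i).resolve_right h.symm
        rw [hy] at h ⊢
        simpa [h] using hwmin i
    have hsum := Finset.sum_le_sum fun i (_ : i ∈ Finset.univ) => hterm i
    rw [Finset.sum_sub_distrib, ← Finset.sum_filter, Finset.sum_const, nsmul_eq_mul] at hsum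
    have : (hammingDist (τ x) y : ℝ) * wmin ≤ s * wmin := by
      refine le_trans (hsum.trans ?_) hs
      change W y - W (τ x) ≤ _
      linarith
    exact le_of_mul_le_mul_right this hmin
  refine ⟨Z, ?_, fun x => ?_, fun y => ?_⟩
  · have hr := rank_sub_restrict_le (kroneckerProd E) (fun x => p (τ x)) q
    have hr' : ((kroneckerProd E - Z).rank : ℝ) ≤
        (Finset.univ.filter fun x => p (τ x)).card + (Finset.univ.filter q).card := by
      exact_mod_cast hr
    have hcard : (Finset.univ.filter fun x => p (τ x)).card = (Finset.univ.filter p).card :=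
      Finset.card_equiv τ (by simp)
    rw [hcard] at hr'
    have h1 := card_weight_deviation_le hd a w hw wmax hmax hwmax δ hδ hδ1 1 (by simp)
    have h2 := card_weight_deviation_le hd a w hw wmax hmax hwmax δ hδ hδ1 (-1) (by simp)
    calc ((kroneckerProd E - Z).rank : ℝ) ≤ _ := hr'
      _ ≤ _ := add_le_add (by convert h2) (by convert h1)
      _ = _ := by ring
  · refine Nat.le_floor (le_trans ?_ (card_hammingBall_le (τ x) s θ hθ hθ1))
    rw [← Set.ncard_coe_finset, Nat.cast_le]
    refine Set.ncard_le_ncard (fun y hy => ?_) (Finset.finite_toSet _)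
    simpa [hammingDist_comm] using hZ x y hy
  · refine Nat.le_floor (le_trans ?_ (card_hammingBall_le y s θ hθ hθ1))
    rw [← Set.ncard_coe_finset, Nat.cast_le,
      ← Set.ncard_image_of_injective {x | Z x y ≠ 0} τ.injective]
    refine Set.ncard_le_ncard ?_ (Finset.finite_toSet _)
    rintro _ ⟨x, hx, rfl⟩
    simpa using hZ x y hx

end Stage

/-! ### Parameters and conclusion -/

/-- The choice of the relative deviation in the proof of `theorem5p1`. -/
theorem deviation_parameter_bounds {K ε : ℝ} (hK : 1 ≤ K) (hε : 0 < ε) (hε1 : ε < 1) :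
    0 < ε / (100 * Real.log (2 * K / ε)) ∧ ε / (100 * Real.log (2 * K / ε)) ≤ 1 ∧
      7 * (ε / (100 * Real.log (2 * K / ε))) + 2 * (ε / (100 * Real.log (2 * K / ε))) *
        (Real.log (1 / (ε / (100 * Real.log (2 * K / ε)))) / Real.log 2) ≤ ε := by
  have hl2 := Real.log_two_gt_d9
  have hlε : Real.log (2 * K / ε) = Real.log 2 + Real.log K - Real.log ε := by
    rw [Real.log_div (by positivity) hε.ne', Real.log_mul (by norm_num) (by positivity)]
  have hlogε : Real.log ε < 0 := Real.log_neg hε hε1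
  have hlogK : 0 ≤ Real.log K := Real.log_nonneg hK
  set l := Real.log (2 * K / ε) with hl
  have hl0 : 0 < l := by linarith
  have hκ : 0 < ε / (100 * l) := by positivity
  have hκl : ε / (100 * l) * l = ε / 100 := by field_simp
  have hκ1 : ε / (100 * l) ≤ 1 := by
    rw [div_le_one (by positivity)]
    linarith
  refine ⟨hκ, hκ1, ?_⟩
  have h100 : Real.log 100 ≤ 7 * Real.log 2 := by
    have : (7 : ℝ) * Real.log 2 = Real.log (2 ^ 7) := by rw [Real.log_pow]; norm_num
    rw [this]
    exact Real.log_le_log (by norm_num) (by norm_num)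
  have hlogκ : Real.log (1 / (ε / (100 * l))) ≤ 9 * l := by
    rw [one_div_div, Real.log_div (by positivity) hε.ne',
      Real.log_mul (by norm_num) hl0.ne']
    have := Real.log_le_sub_one_of_pos hl0
    linarith
  have h1 : Real.log (1 / (ε / (100 * l))) / Real.log 2 ≤ 18 * l := by
    rw [div_le_iff₀ (by linarith)]
    nlinarith
  nlinarith [mul_le_mul_of_nonneg_left h1 hκ.le]

/-- The matrices are `M 0, …, M k`, so that `d 0` is the smallest size and `d (Fin.last k)` the
largest one. -/
theorem theorem5p1 :
    ∃ c : ℝ, 0 < c ∧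
      ∀ (𝔽 : Type*) [Field 𝔽] (ε : ℝ) (_ : 0 < ε) (_ : ε < 1)
        (w : ℝ → ℝ) (_ : ∀ x, 1 ≤ w x) (_ : Monotone w)
        (k : ℕ) (d : Fin (k + 1) → ℕ) (_ : ∀ i, 2 ≤ d i) (_ : Monotone d)
        (K L : ℝ) (_ : 0 < K) (_ : 0 < L)
        (_ : ∑ i, w (d i) / d i ≤
          K * (∑ i, Real.log (d i) / Real.log (d (Fin.last k))) * (w (d 0) / d (Fin.last k)))
        (_ : ∑ i, w (d i) / d i ≥
          L * (∑ i, Real.log (d i) / Real.log (d (Fin.last k))) *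
            (w (d (Fin.last k)) / d (Fin.last k)))
        (M : (i : Fin (k + 1)) → Matrix (Fin (d i)) (Fin (d i)) 𝔽)
        (n : ℕ) (_ : n = ∏ i, d i)
        (γ : ℝ) (_ : γ = c * L * ε ^ 2 /
          (d (Fin.last k) * Real.log (d (Fin.last k)) *
            (K ^ 2 * Real.log (2 * K / ε) ^ 2))),
        (rcRigidity (kroneckerProd M) (2 * d (Fin.last k) * (n : ℝ) ^ (1 - γ)) : ℝ) ≤
          (n : ℝ) ^ ε := by
  -- `40000 = 4 * 100 ^ 2`: the Chernoff exponent carries `δ ^ 2 / 4`, with `δ = κ / K` and the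
  -- `100` in `κ`.
  refine ⟨1 / 40000, by norm_num, ?_⟩
  intro 𝔽 _ ε hε hε1 w hw1 hw k d hd2 hd K L hK hL hKS hLS M n hn γ hγ
  have hl2 := Real.log_two_gt_d9
  set D := d (Fin.last k) with hD
  have hD2 : (2 : ℝ) ≤ D := by exact_mod_cast hd2 _
  have hdD : ∀ i, (d i : ℝ) ≤ D := fun i => by exact_mod_cast hd (Fin.le_last i)
  have hd2' : ∀ i, (2 : ℝ) ≤ d i := fun i => by exact_mod_cast hd2 i
  have hd0 : ∀ i, (d 0 : ℝ) ≤ d i := fun i => by exact_mod_cast hd (Fin.zero_le i)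
  have hlogd : ∀ i, Real.log 2 ≤ Real.log (d i) := fun i =>
    Real.log_le_log (by norm_num) (hd2' i)
  have hlD : Real.log 2 ≤ Real.log D := Real.log_le_log (by norm_num) hD2
  have hlD0 : 0 < Real.log D := by linarith
  have hnR : (n : ℝ) = ∏ i, (d i : ℝ) := by rw [hn]; push_cast; rfl
  have hnpos : (0 : ℝ) < n := by
    rw [hnR]
    exact Finset.prod_pos fun i _ => by linarith [hd2' i]
  have hlogn : ∑ i, Real.log (d i) = Real.log n := by
    rw [hnR, Real.log_prod fun i _ => by linarith [hd2' i]]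
  have hkN : ((k + 1 : ℕ) : ℝ) * Real.log 2 ≤ Real.log n := by
    rw [← hlogn]
    refine le_trans (le_of_eq ?_) (Finset.sum_le_sum fun i _ => hlogd i)
    simp
  set N := Real.log n with hN
  have hk0 : (0 : ℝ) < (k + 1 : ℕ) := by positivity
  have hN0 : 0 < N := lt_of_lt_of_le (by positivity) hkN
  rw [← Finset.sum_div, hlogn] at hKS hLS
  set S := ∑ i, w (d i) / d i with hS
  have hw0 : 0 < w (d 0) := by linarith [hw1 (d 0)]
  have hwD : 0 < w D := by linarith [hw1 D]
  -- Each `w (d i) / d i` is at least `w (d 0) / D`, which (i) allows only for `K ≥ 1`.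
  have hK1 : 1 ≤ K := by
    have hlow : N / Real.log D * (w (d 0) / D) ≤ S := by
      rw [← hlogn, Finset.sum_div, Finset.sum_mul]
      refine Finset.sum_le_sum fun i _ => ?_
      have hdi := hd2' i
      have h1 : Real.log (d i) / Real.log D ≤ 1 :=
        (div_le_one hlD0).2 (Real.log_le_log (by linarith) (hdD i))
      calc Real.log (d i) / Real.log D * (w (d 0) / D) ≤ 1 * (w (d 0) / D) := by gcongr
        _ ≤ w (d i) / d i := by
          rw [one_mul]
          exact div_le_div₀ (by linarith [hw1 (d i)]) (hw (hd0 i)) (by linarith) (hdD i)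
    have hpos : 0 < N / Real.log D * (w (d 0) / D) := by positivity
    rw [mul_assoc] at hKS
    by_contra! hlt
    nlinarith
  obtain ⟨hκ, hκ1, hκε⟩ := deviation_parameter_bounds hK1 hε hε1
  set κ := ε / (100 * Real.log (2 * K / ε)) with hκdef
  have hlogκ : 0 ≤ Real.log (1 / κ) := Real.log_nonneg (by rw [le_div_iff₀ hκ]; linarith)
  have hstage := fun E => exists_sparse_of_isSpecial (𝔽 := 𝔽) (d := d)
    (fun i => by linarith [hd2 i])
    (fun i => w (d i)) (w (d 0)) (w D) hw0 (fun i => hw (hd0 i)) hwD (fun i => hw (hdD i))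
    (κ / K) (by positivity) (by rw [div_le_one hK]; linarith)
    -- The radius is what (i) yields; `θ = κ / D ^ 3` keeps the volume term of all `D` stages below
    -- `κ * N`, and `log (1 / θ)` costs only `3 * log D + log (1 / κ)`.
    (2 * κ * N / (D * Real.log D)) (κ / D ^ 3)
    (by
      calc 2 * (κ / K) * S ≤ 2 * (κ / K) * (K * (N / Real.log D) * (w (d 0) / D)) := by gcongr
        _ = _ := by field_simp)
    (by positivity)
    (by
      rw [div_le_one (by positivity)]
      exact hκ1.trans (one_le_pow₀ (by linarith))) E
  have hprod : ∀ i, IsSpecialProd D (M i) := fun i => by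
    have : Nonempty (Fin (d i)) := ⟨⟨0, by linarith [hd2 i]⟩⟩
    have h := isSpecialProd_card (M i)
    rw [Fintype.card_fin] at h
    exact h.mono (hd (Fin.le_last i))
  obtain ⟨Z, hrank, hsparse⟩ := exists_sparse_of_isSpecialProd _ _ hstage D M hprod
  refine le_trans (Nat.cast_le.2 (Nat.sInf_le ⟨Z, hrank.trans ?_, hsparse⟩)) ?_
  · rw [← hnR, Real.rpow_sub hnpos, Real.rpow_one, Real.rpow_def_of_pos hnpos,
      div_eq_mul_inv (n : ℝ), ← Real.exp_neg]
    have hexp : N * γ ≤ (κ / K) ^ 2 / 4 * (S / w D) := by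
      have h1 : L * (N / Real.log D) / D ≤ S / w D := by
        rw [le_div_iff₀ hwD]
        refine le_trans (le_of_eq ?_) hLS
        ring
      have hlog : 0 < Real.log (2 * K / ε) :=
        Real.log_pos (by rw [lt_div_iff₀ hε]; linarith)
      calc N * γ = (κ / K) ^ 2 / 4 * (L * (N / Real.log D) / D) := by
            rw [hγ, hκdef]
            field_simp
            norm_num
        _ ≤ _ := by gcongr
    calc _ ≤ (D : ℝ) * (2 * (n * Real.exp (-(N * γ)))) := by gcongr
      _ = _ := by ring
  · push_cast
    refine (pow_le_pow_left₀ (Nat.cast_nonneg _) (Nat.floor_le (Real.exp_nonneg _)) D).trans ?_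
    rw [← Real.exp_nat_mul, Real.rpow_def_of_pos hnpos, Real.exp_le_exp]
    have hsumd : ∑ i, (d i : ℝ) ≤ 2 * N * D := by
      calc ∑ i, (d i : ℝ) ≤ ∑ _i : Fin (k + 1), (D : ℝ) := Finset.sum_le_sum fun i _ => hdD i
        _ = (k + 1 : ℕ) * (D : ℝ) := by simp
        _ ≤ 2 * N * D := by
          refine mul_le_mul_of_nonneg_right ?_ (by linarith)
          nlinarith
    have hlogθ : Real.log (1 / (κ / D ^ 3)) = 3 * Real.log D + Real.log (1 / κ) := by
      rw [one_div_div, div_eq_mul_one_div, Real.log_mul (by positivity) (by positivity),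
        Real.log_pow]
      norm_num
    have h1 : D * (κ / D ^ 3 * ∑ i, (d i : ℝ)) ≤ κ * N := by
      calc D * (κ / D ^ 3 * ∑ i, (d i : ℝ)) ≤ D * (κ / D ^ 3 * (2 * N * D)) := by gcongr
        _ = κ * N * (2 / D) := by field_simp
        _ ≤ κ * N * 1 := by
          refine mul_le_mul_of_nonneg_left ?_ (by positivity)
          rw [div_le_one (by linarith)]
          exact hD2
        _ = _ := mul_one _
    have h2 : D * (2 * κ * N / (D * Real.log D) * Real.log (1 / (κ / D ^ 3))) ≤
        N * (6 * κ + 2 * κ * (Real.log (1 / κ) / Real.log 2)) := by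
      rw [hlogθ]
      calc D * (2 * κ * N / (D * Real.log D) * (3 * Real.log D + Real.log (1 / κ))) =
          N * (6 * κ + 2 * κ * (Real.log (1 / κ) / Real.log D)) := by field_simp; ring
        _ ≤ _ := by gcongr
    rw [mul_add]
    nlinarith [mul_le_mul_of_nonneg_left hκε hN0.le]
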